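/- Let $\lambda_{BS}>0$, $0<p\le 1$, $D>0$, $\beta\in\mathbb{R}$, and for $j\in\{L,N\}$ (line of sight / non line of sight) let $\alpha_j>0$ and $\xi_j>0$. Let $\Phi_L$ and $\Phi_N$ be Poisson point processes on $\mathbb{R}^2$ with intensity functions $\lambda_{BS}\,p\,\mathbf 1_{\{\|x\|\le D\}}$ and $\lambda_{BS}(1-p)\mathbf 1_{\{\|x\|\le D\}}+\lambda_{BS}\mathbf 1_{\{\|x\|>D\}}$, respectively. For each $j$, let the points $y\in\Phi_j$ carry i.i.d. marks $\chi_{y,j}\sim N(0,\xi_j^2)$, independent of $\Phi_j$, put $S_{y,j}=10^{-(\beta+\chi_{y,j})/10}$, and let $\mathcal N_j=\{\|y\|^{\alpha_j}/S_{y,j}: y\in\Phi_j\}\subset[0,\infty)$ be the propagation process. Let $Q$ be the complementary distribution function of the standard Gaussian law, $m=-0.1\,\beta\ln 10$, $\sigma_j=0.1\,\xi_j\ln 10$, $\Upsilon_j(t)=\bigl(\ln(D^{\alpha_j}/t)-m\bigr)/\sigma_j$, $c_j=\exp\bigl(\tfrac{2\sigma_j^2}{\alpha_j^2}+\tfrac{2m}{\alpha_j}\bigr)$,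 and for $t>0$ $$M_L(t)=\pi p\Bigl[D^2Q(\Upsilon_L(t))+t^{2/\alpha_L}c_L\,Q\bigl(\tfrac{2\sigma_L^2}{\alpha_L\sigma_L}-\Upsilon_L(t)\bigr)\Bigr],$$ $$M_N(t)=-\pi pD^2Q(\Upsilon_N(t))+\pi t^{2/\alpha_N}c_N\Bigl[1-p\,Q\bigl(\tfrac{2\sigma_N^2}{\alpha_N\sigma_N}-\Upsilon_N(t)\bigr)\Bigr].$$ Let $B_j=\mathbb P(\mathcal N_j\neq\emptyset)$. Then $B_L=1-e^{-\lambda_{BS}\pi pD^2}$ and $B_N=1$. The functions $M_L,M_N$ are differentiable on $(0,\infty)$ with derivatives $$M_L'(t)=\pi p\Bigl\{c_L\,t^{\frac{2}{\alpha_L}-1}\Bigl[\tfrac{2}{\alpha_L}Q\bigl(\tfrac{2\sigma_L^2}{\alpha_L\sigma_L}-\Upsilon_L(t)\bigr)-\tfrac{1}{\sqrt{2\pi\sigma_L^2}}e^{-\left(\frac{\sqrt2\sigma_L}{\alpha_L}-\frac{\Upsilon_L(t)}{\sqrt2}\right)^2}\Bigr]+\tfrac{D^2}{\sqrt{2\pi}\,t\,\sigma_L}e^{-\Upsilon_L(t)^2/2}\Bigr\},$$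 $$M_N'(t)=\pi p\Bigl\{c_N\,t^{\frac{2}{\alpha_N}-1}\Bigl[\tfrac{2}{p\alpha_N}-\tfrac{2}{\alpha_N}Q\bigl(\tfrac{2\sigma_N^2}{\alpha_N\sigma_N}-\Upsilon_N(t)\bigr)+\tfrac{1}{\sqrt{2\pi\sigma_N^2}}e^{-\left(\frac{\sqrt2\sigma_N}{\alpha_N}-\frac{\Upsilon_N(t)}{\sqrt2}\right)^2}\Bigr]-\tfrac{D^2}{\sqrt{2\pi}\,t\,\sigma_N}e^{-\Upsilon_N(t)^2/2}\Bigr\}.$$ Moreover, for $j=L$ (resp. $j=N$), conditionally on $\mathcal N_j\neq\emptyset$, almost surely $\mathcal N_j$ has a point nearest to the origin, and its distance to the origin has, on $(0,\infty)$, the probability density function $$f_j(t)=\lambda_{BS}\exp\bigl(-\lambda_{BS}M_j(t)\bigr)\,M_j'(t)/B_j .$$ -/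

import Mathlib

open MeasureTheory ProbabilityTheory

noncomputable section

namespace MmWave

/-- State of a link: line of sight or non line of sight. -/
inductive LinkType where
  | LOS
  | NLOS

/-- Numerical parameters of the network. -/
structure Params where
  /-- density of the base stations -/
  lam : ℝ
  /-- probability that a link of length at most `D` is line of sight -/
  p : ℝ
  /-- radius beyond which every link is non line of sight -/
  D : ℝ
  /-- path loss in dB at the reference distance 1 -/
  beta : ℝ
  /-- path loss exponents -/
  alpha : LinkType → ℝ
  /-- standard deviations (in dB) of the shadowing -/
  xi : LinkType → ℝ

/-- The plane in which the base stations lie; the typical user is at the origin. -/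
abbrev Plane := EuclideanSpace ℝ (Fin 2)

/-! ### Poisson point processes -/

/-- A random, finite or infinite, sequence of points of `E`: the points are `pt n ω` for the
indices `n` with `n < num ω` (the values `pt n ω` for `n ≥ num ω` are not used). -/
structure RandomPoints (Ω E : Type*) where
  /-- the total number of points -/
  num : Ω → ℕ∞
  /-- the points -/
  pt : ℕ → Ω → E

/-- Number of points in the set `A`. -/
def RandomPoints.count {Ω E : Type*} (Φ : RandomPoints Ω E) (A : Set E) (ω : Ω) : ℕ∞ :=
  {n : ℕ | (n : ℕ∞) < Φ.num ω ∧ Φ.pt n ω ∈ A}.encard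

/-- `Φ` is a Poisson point process with intensity measure `Λ`: the numbers of points in
measurable sets of finite intensity are Poisson distributed with mean the intensity of the set,
and the numbers of points in disjoint measurable sets are independent. -/
structure IsPoissonProcess {Ω E : Type*} [MeasurableSpace Ω] [MeasurableSpace E]
    (Φ : RandomPoints Ω E) (Λ : Measure E) (μ : Measure Ω) : Prop where
  measurable_num : Measurable Φ.num
  measurable_pt : ∀ n, Measurable (Φ.pt n)
  map_count : ∀ A : Set E, MeasurableSet A → Λ A ≠ ⊤ →
    μ.map (Φ.count A) = (poissonMeasure (Λ A).toNNReal).map (fun k : ℕ => (k : ℕ∞))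
  indep_count : ∀ (k : ℕ) (A : Fin k → Set E), (∀ i, MeasurableSet (A i)) →
    Pairwise (fun i i' => Disjoint (A i) (A i')) → iIndepFun (fun i => Φ.count (A i)) μ

/-- The sequence `χ` consists of independent real marks with common law `ν`, and it is independent
of the points `Φ`. -/
structure IsIndepMarking {Ω E : Type*} [MeasurableSpace Ω] [MeasurableSpace E]
    (Φ : RandomPoints Ω E) (χ : ℕ → Ω → ℝ) (ν : Measure ℝ) (μ : Measure Ω) : Prop where
  measurable_mark : ∀ n, Measurable (χ n)
  map_mark : ∀ n, μ.map (χ n) = ν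
  iIndep_mark : iIndepFun χ μ
  indep_points : IndepFun (fun ω => (Φ.num ω, fun n => Φ.pt n ω)) (fun ω n => χ n ω) μ

/-! ### Base stations and propagation losses -/

/-- Intensity function of the base stations of type `j`:
`λ p 1{‖x‖ ≤ D}` for LOS, and `λ (1 - p) 1{‖x‖ ≤ D} + λ 1{‖x‖ > D}` for NLOS. -/
def density (P : Params) : LinkType → Plane → ℝ
  | .LOS, x => if ‖x‖ ≤ P.D then P.lam * P.p else 0
  | .NLOS, x => if ‖x‖ ≤ P.D then P.lam * (1 - P.p) else P.lam

/-- Intensity measure of the base stations of type `j`. -/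
def intensity (P : Params) (j : LinkType) : Measure Plane :=
  (volume : Measure Plane).withDensity (fun x => ENNReal.ofReal (density P j x))

/-- `Φ` is the process of the base stations of type `j`, and `χ n` is the shadowing in dB, with law
`N(0, ξ_j ^ 2)`, on the link from its `n`-th point to the origin. -/
structure IsBSProcess {Ω : Type*} [MeasurableSpace Ω] (P : Params) (j : LinkType)
    (Φ : RandomPoints Ω Plane) (χ : ℕ → Ω → ℝ) (μ : Measure Ω) : Prop where
  poisson : IsPoissonProcess Φ (intensity P j) μ
  marking : IsIndepMarking Φ χ (gaussianReal 0 (P.xi j ^ 2).toNNReal) μ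

/-- The lognormal gain in linear scale: `S = 10 ^ (-(β + χ) / 10)` when the shadowing is `χ` dB. -/
def gain (P : Params) (s : ℝ) : ℝ := (10 : ℝ) ^ (-(P.beta + s) / 10)

/-- Propagation loss `‖x‖ ^ α_j / S` of the link from `x` to the origin, in linear scale. -/
def loss (P : Params) (j : LinkType) (x : Plane) (s : ℝ) : ℝ := ‖x‖ ^ P.alpha j / gain P s

/-- The propagation process: the set of the propagation losses of all points of `Φ`. -/
def propagation {Ω : Type*} (P : Params) (j : LinkType) (Φ : RandomPoints Ω Plane)
    (χ : ℕ → Ω → ℝ) (ω : Ω) : Set ℝ :=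
  {l | ∃ n : ℕ, (n : ℕ∞) < Φ.num ω ∧ l = loss P j (Φ.pt n ω) (χ n ω)}

/-- The event that the propagation process is not empty. -/
def nonemptyEvent {Ω : Type*} (P : Params) (j : LinkType) (Φ : RandomPoints Ω Plane)
    (χ : ℕ → Ω → ℝ) : Set Ω :=
  {ω | (propagation P j Φ χ ω).Nonempty}

/-- The distance from the origin to the nearest point of the propagation process (a subset of
`[0, ∞)`). -/
def nearest {Ω : Type*} (P : Params) (j : LinkType) (Φ : RandomPoints Ω Plane)
    (χ : ℕ → Ω → ℝ) (ω : Ω) : ℝ :=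
  sInf (propagation P j Φ χ ω)

/-! ### The explicit functions -/

/-- The Q-function, that is the complementary distribution function of the standard Gaussian. -/
def Q (x : ℝ) : ℝ := (gaussianReal 0 1).real (Set.Ioi x)

/-- `m = -0.1 β ln 10`. -/
def m (P : Params) : ℝ := -(1 / 10) * P.beta * Real.log 10

/-- `σ_j = 0.1 ξ_j ln 10`. -/
def sigma (P : Params) (j : LinkType) : ℝ := (1 / 10) * P.xi j * Real.log 10

/-- `Υ_j(t) = (ln (D ^ α_j / t) - m) / σ_j`. -/
def Upsilon (P : Params) (j : LinkType) (t : ℝ) : ℝ :=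
  (Real.log (P.D ^ P.alpha j / t) - m P) / sigma P j

/-- `exp (2 σ_j ^ 2 / α_j ^ 2 + 2 m / α_j)`. -/
def expConst (P : Params) (j : LinkType) : ℝ :=
  Real.exp (2 * sigma P j ^ 2 / P.alpha j ^ 2 + 2 * m P / P.alpha j)

/-- `Q (2 σ_j ^ 2 / (α_j σ_j) - Υ_j(t))`. -/
def qShift (P : Params) (j : LinkType) (t : ℝ) : ℝ :=
  Q (2 * sigma P j ^ 2 / (P.alpha j * sigma P j) - Upsilon P j t)

/-- The functions `M_L` and `M_N`. -/
def M (P : Params) : LinkType → ℝ → ℝ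
  | .LOS, t => Real.pi * P.p *
      (P.D ^ 2 * Q (Upsilon P .LOS t)
        + t ^ (2 / P.alpha .LOS) * expConst P .LOS * qShift P .LOS t)
  | .NLOS, t => -(Real.pi * P.p * P.D ^ 2 * Q (Upsilon P .NLOS t))
      + Real.pi * t ^ (2 / P.alpha .NLOS) * expConst P .NLOS * (1 - P.p * qShift P .NLOS t)

/-- `(2 π σ_j ^ 2) ^ (-1/2) exp (-(√2 σ_j / α_j - Υ_j(t) / √2) ^ 2)`. -/
def gaussTerm (P : Params) (j : LinkType) (t : ℝ) : ℝ :=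
  1 / √(2 * Real.pi * sigma P j ^ 2)
    * Real.exp (-(√2 * sigma P j / P.alpha j - Upsilon P j t / √2) ^ 2)

/-- `D ^ 2 / (√(2 π) t σ_j) exp (-Υ_j(t) ^ 2 / 2)`. -/
def edgeTerm (P : Params) (j : LinkType) (t : ℝ) : ℝ :=
  P.D ^ 2 / (√(2 * Real.pi) * t * sigma P j) * Real.exp (-Upsilon P j t ^ 2 / 2)

/-- The explicit functions `M'_L` and `M'_N`. -/
def M' (P : Params) : LinkType → ℝ → ℝ
  | .LOS, t => Real.pi * P.p *
      (expConst P .LOS * t ^ (2 / P.alpha .LOS - 1)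
          * (2 / P.alpha .LOS * qShift P .LOS t - gaussTerm P .LOS t)
        + edgeTerm P .LOS t)
  | .NLOS, t => Real.pi * P.p *
      (expConst P .NLOS * t ^ (2 / P.alpha .NLOS - 1)
          * (2 / (P.p * P.alpha .NLOS) - 2 / P.alpha .NLOS * qShift P .NLOS t
              + gaussTerm P .NLOS t)
        - edgeTerm P .NLOS t)

/-- Value of the probability that the propagation process of type `j` is not empty:
`B_L = 1 - exp (-λ π p D ^ 2)` and `B_N = 1`. -/
def B (P : Params) : LinkType → ℝ
  | .LOS => 1 - Real.exp (-(P.lam * Real.pi * P.p * P.D ^ 2))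
  | .NLOS => 1

/-- `f_j(t) = λ exp (-λ M_j(t)) M'_j(t) / B_j`, the density on `(0, ∞)`. -/
def f (P : Params) (j : LinkType) (t : ℝ) : ℝ :=
  P.lam * Real.exp (-(P.lam * M P j t)) * M' P j t / B P j

end MmWave

end

/-!
Averaging over the marks turns the probability that an independently marked Poisson process has no
point in a set `T` into the probability generating functional of the process, hence into
`exp (-(Λ ⊗ ν)(T))`. The nearest point of the propagation process is farther than `t` exactly when
no marked base station has loss at most `t`. For a given shadowing these base stations lie in a
disk, and the Gaussian average of the intensity of this disk is `λ M_j(t)`. The conditional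
distribution function of the nearest distance is thus `(1 - exp (-λ M_j(t))) / B_j`, which is
differentiated explicitly.
-/

namespace MmWave

open Filter Topology Set
open scoped ENNReal NNReal Function

/-! ### The exponential of a negated extended nonnegative real -/

/-- The function `x ↦ e ^ (-x)` on `[0, ∞]`, with `e ^ (-∞) = 0`, so that the formula for void
probabilities holds for sets of infinite intensity as well. -/
noncomputable def expNeg (x : ℝ≥0∞) : ℝ≥0∞ := EReal.exp (-(x : EReal))

lemma expNeg_zero : expNeg 0 = 1 := by simp [expNeg]

lemma expNeg_top : expNeg ⊤ = 0 := by simp [expNeg]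

lemma expNeg_ofReal {x : ℝ} (hx : 0 ≤ x) :
    expNeg (ENNReal.ofReal x) = ENNReal.ofReal (Real.exp (-x)) := by
  rw [expNeg, EReal.coe_ennreal_ofReal, max_eq_left hx, ← EReal.coe_neg, EReal.exp_coe]

lemma expNeg_add (x y : ℝ≥0∞) : expNeg (x + y) = expNeg x * expNeg y := by
  rw [expNeg, EReal.coe_ennreal_add, EReal.neg_add (by simp) (by simp), sub_eq_add_neg,
    EReal.exp_add, expNeg, expNeg]

lemma expNeg_sum {ι : Type*} (s : Finset ι) (x : ι → ℝ≥0∞) :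
    expNeg (∑ i ∈ s, x i) = ∏ i ∈ s, expNeg (x i) := by
  induction s using Finset.cons_induction with
  | empty => simp [expNeg_zero]
  | cons i s hi ih => rw [Finset.sum_cons, Finset.prod_cons, expNeg_add, ih]

lemma expNeg_ne_top (x : ℝ≥0∞) : expNeg x ≠ ⊤ := by simp [expNeg]

lemma continuous_expNeg : Continuous expNeg :=
  ENNReal.continuous_exp.comp (continuous_neg.comp continuous_coe_ennreal_ereal)

lemma one_sub_expNeg_ofReal {x : ℝ} (hx : 0 ≤ x) :
    1 - expNeg (ENNReal.ofReal x) = ENNReal.ofReal (1 - Real.exp (-x)) := by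
  rw [expNeg_ofReal hx, ENNReal.ofReal_sub _ (Real.exp_pos _).le, ENNReal.ofReal_one]

/-! ### Generating functions of Poisson variables -/

lemma hasSum_pow_mul_poisson (r q : ℝ) :
    HasSum (fun k : ℕ => q ^ k * (Real.exp (-r) * r ^ k / k.factorial))
      (Real.exp (-((1 - q) * r))) := by
  have h := (NormedSpace.expSeries_div_hasSum_exp (q * r)).mul_left (Real.exp (-r))
  rw [← Real.exp_eq_exp_ℝ, ← Real.exp_add, show -r + q * r = -((1 - q) * r) by ring] at h
  refine h.congr_fun fun k => ?_
  rw [mul_pow]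
  ring

lemma lintegral_one_sub_pow_poissonMeasure (r : ℝ≥0) {c : ℝ≥0∞} (hc : c ≤ 1) :
    ∫⁻ k, (1 - c) ^ k ∂(poissonMeasure r) = expNeg (c * r) := by
  lift c to ℝ≥0 using ne_top_of_le_ne_top ENNReal.one_ne_top hc
  have hq : 0 ≤ 1 - (c : ℝ) := sub_nonneg.2 (by exact_mod_cast hc)
  have hterm : ∀ k : ℕ, (1 - (c : ℝ≥0∞)) ^ k * poissonMeasure r {k} =
      ENNReal.ofReal ((1 - (c : ℝ)) ^ k * (Real.exp (-r) * r ^ k / k.factorial)) := fun k => by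
    rw [poissonMeasure_singleton, ENNReal.ofReal_mul (by positivity), ENNReal.ofReal_pow hq,
      ENNReal.ofReal_sub _ c.coe_nonneg, ENNReal.ofReal_one, ENNReal.ofReal_coe_nnreal]
  have hs := hasSum_pow_mul_poisson r (1 - c)
  rw [lintegral_countable', tsum_congr hterm,
    ← ENNReal.ofReal_tsum_of_nonneg (fun k => by positivity) hs.summable, hs.tsum_eq,
    sub_sub_cancel, ← expNeg_ofReal (by positivity), ENNReal.ofReal_mul c.coe_nonneg,
    ENNReal.ofReal_coe_nnreal, ENNReal.ofReal_coe_nnreal]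

/-! ### Infinite products of factors at most one -/

lemma tprod_iInf_of_antitone {ι : Type*} {g : ℕ → ι → ℝ≥0∞} (hg : Antitone g)
    (hg1 : ∀ k i, g k i ≤ 1) : ∏' i, ⨅ k, g k i = ⨅ k, ∏' i, g k i := by
  have hprod : ∀ s : Finset ι, ∏ i ∈ s, ⨅ k, g k i = ⨅ k, ∏ i ∈ s, g k i := fun s => by
    refine tendsto_nhds_unique (ENNReal.tendsto_finsetProd_of_ne_top s
      (fun i _ => tendsto_atTop_iInf fun k l hkl => hg hkl i) fun i _ => ?_)
      (tendsto_atTop_iInf fun k l hkl => Finset.prod_le_prod' fun i _ => hg hkl i)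
    exact ne_top_of_le_ne_top ENNReal.one_ne_top (iInf_le_of_le 0 (hg1 0 i))
  rw [ENNReal.tprod_eq_iInf_prod fun i => iInf_le_of_le 0 (hg1 0 i)]
  simp_rw [fun k => ENNReal.tprod_eq_iInf_prod (hg1 k), hprod]
  exact iInf_comm

lemma finprod_mem_const {ι M : Type*} [CommMonoid M] {A : Set ι} (hA : A.Finite) (c : M) :
    ∏ᶠ _ ∈ A, c = c ^ A.ncard := by
  rw [finprod_mem_eq_finite_toFinset_prod _ hA, Finset.prod_const, ncard_eq_toFinset_card A hA]

/-! ### The probability generating functional of a Poisson process -/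

section Points

variable {Ω E : Type*}

/-- The product of `g` over the points of `Φ`, the argument of the probability generating
functional. -/
noncomputable def RandomPoints.prod (Φ : RandomPoints Ω E) (g : E → ℝ≥0∞) (ω : Ω) : ℝ≥0∞ :=
  ∏' n : ℕ, {n : ℕ | (n : ℕ∞) < Φ.num ω}.mulIndicator (fun n => g (Φ.pt n ω)) n

lemma RandomPoints.prod_eq_iInf (Φ : RandomPoints Ω E) {g : E → ℝ≥0∞} (hg : ∀ x, g x ≤ 1) (ω : Ω) :
    Φ.prod g ω = ⨅ s : Finset ℕ,
      ∏ n ∈ s, {n : ℕ | (n : ℕ∞) < Φ.num ω}.mulIndicator (fun n => g (Φ.pt n ω)) n :=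
  ENNReal.tprod_eq_iInf_prod fun n => mulIndicator_le_one (fun n _ => hg (Φ.pt n ω)) n

lemma RandomPoints.prod_mono (Φ : RandomPoints Ω E) {g g' : E → ℝ≥0∞} (h : g ≤ g')
    (hg' : ∀ x, g' x ≤ 1) : Φ.prod g ≤ Φ.prod g' := fun ω => by
  rw [Φ.prod_eq_iInf (fun x => (h x).trans (hg' x)), Φ.prod_eq_iInf hg']
  exact iInf_mono fun s => Finset.prod_le_prod' fun n _ => mulIndicator_le_mulIndicator (h _)

lemma RandomPoints.prod_one_sub_iSup (Φ : RandomPoints Ω E) {s : ℕ → E → ℝ≥0∞} (hs : Monotone s)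
    (ω : Ω) : Φ.prod (fun x => 1 - ⨆ k, s k x) ω = ⨅ k, Φ.prod (fun x => 1 - s k x) ω := by
  simp only [prod]
  rw [← tprod_iInf_of_antitone]
  · refine tprod_congr fun n => ?_
    by_cases hn : (n : ℕ∞) < Φ.num ω
    · simp [hn, mulIndicator, ENNReal.sub_iSup ENNReal.one_ne_top]
    · simp [hn, mulIndicator]
  · exact fun k l hkl n => mulIndicator_le_mulIndicator (tsub_le_tsub_left (hs hkl _) 1)
  · exact fun k n => mulIndicator_le_one (fun _ _ => tsub_le_self) n

lemma RandomPoints.prod_one_sub_simpleFunc [MeasurableSpace E] (Φ : RandomPoints Ω E)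
    (s : SimpleFunc E ℝ≥0∞) {ω : Ω} (hω : ∀ c ∈ s.range, c ≠ 0 → Φ.count (s ⁻¹' {c}) ω ≠ ⊤) :
    Φ.prod (fun x => 1 - s x) ω =
      ∏ c ∈ s.range, (1 - c) ^ (Φ.count (s ⁻¹' {c}) ω).toNat := by
  let A : ℝ≥0∞ → Set ℕ := fun c => {n | (n : ℕ∞) < Φ.num ω ∧ Φ.pt n ω ∈ s ⁻¹' {c}}
  have hA : ∀ c ∈ s.range, c ≠ 0 → (A c).Finite := fun c hc hc0 => by
    simpa [RandomPoints.count, A, encard_eq_top_iff] using hω c hc hc0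
  have hfactor : ∀ n, {n : ℕ | (n : ℕ∞) < Φ.num ω}.mulIndicator
      (fun n => 1 - s (Φ.pt n ω)) n = ∏ c ∈ s.range, (A c).mulIndicator (fun _ => 1 - c) n := by
    intro n
    rw [Finset.prod_eq_single_of_mem (s (Φ.pt n ω)) (s.mem_range_self _) fun c _ hc =>
      mulIndicator_of_notMem (fun h => hc h.2.symm) _]
    by_cases hn : (n : ℕ∞) < Φ.num ω <;> simp [A, hn, mulIndicator]
  have hsupp : ∀ c ∈ s.range, Function.HasFiniteMulSupport ((A c).mulIndicator fun _ => 1 - c) := by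
    intro c hc
    rcases eq_or_ne c 0 with rfl | hc0
    · simp [Function.HasFiniteMulSupport]
    · exact (hA c hc hc0).subset mulSupport_mulIndicator_subset
  have hfin : Function.HasFiniteMulSupport
      fun n => ∏ c ∈ s.range, (A c).mulIndicator (fun _ => 1 - c) n :=
    (s.range.finite_toSet.biUnion hsupp).subset (Finset.mulSupport_prod _ _)
  rw [RandomPoints.prod, tprod_congr hfactor, tprod_eq_finprod hfin,
    finprod_prod_comm _ _ hsupp]
  refine Finset.prod_congr rfl fun c hc => ?_
  rcases eq_or_ne c 0 with rfl | hc0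
  · simp
  · rw [← finprod_mem_def, finprod_mem_const (hA c hc hc0)]
    rfl

end Points

section Poisson

variable {Ω E : Type*} [MeasurableSpace Ω] [MeasurableSpace E]
  {Φ : RandomPoints Ω E} {Λ : Measure E} {μ : Measure Ω}

lemma IsPoissonProcess.measurableSet_lt_num (h : IsPoissonProcess Φ Λ μ) (n : ℕ) :
    MeasurableSet {ω | (n : ℕ∞) < Φ.num ω} :=
  h.measurable_num (MeasurableSet.of_discrete (s := Ioi (n : ℕ∞)))

lemma IsPoissonProcess.measurable_count (h : IsPoissonProcess Φ Λ μ) {A : Set E}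
    (hA : MeasurableSet A) : Measurable (Φ.count A) :=
  measurable_encard.comp (measurable_set_iff.2 fun n => measurableSet_setOfPred.1
    ((h.measurableSet_lt_num n).inter (h.measurable_pt n hA)))

lemma IsPoissonProcess.measurable_prod (h : IsPoissonProcess Φ Λ μ) {g : E → ℝ≥0∞}
    (hg : Measurable g) (hg1 : ∀ x, g x ≤ 1) : Measurable (Φ.prod g) := by
  rw [funext (Φ.prod_eq_iInf hg1)]
  exact .iInf fun s => Finset.measurable_prod s fun n _ =>
    .ite (h.measurableSet_lt_num n) (hg.comp (h.measurable_pt n)) measurable_const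

lemma IsPoissonProcess.ae_count_ne_top (h : IsPoissonProcess Φ Λ μ) {A : Set E}
    (hA : MeasurableSet A) (hΛA : Λ A ≠ ⊤) : ∀ᵐ ω ∂μ, Φ.count A ω ≠ ⊤ := by
  refine ae_of_ae_map (p := (· ≠ ⊤)) (h.measurable_count hA).aemeasurable ?_
  rw [h.map_count A hA hΛA, ae_map_iff (by fun_prop) .of_discrete]
  exact ae_of_all _ ENat.natCast_ne_top

lemma IsPoissonProcess.lintegral_one_sub_pow_count (h : IsPoissonProcess Φ Λ μ) {A : Set E}
    (hA : MeasurableSet A) (hΛA : Λ A ≠ ⊤) {c : ℝ≥0∞} (hc : c ≤ 1) :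
    ∫⁻ ω, (1 - c) ^ (Φ.count A ω).toNat ∂μ = expNeg (c * Λ A) := by
  rw [← lintegral_map (f := fun k : ℕ∞ => (1 - c) ^ k.toNat) (measurable_of_countable _)
      (h.measurable_count hA), h.map_count A hA hΛA,
    lintegral_map (measurable_of_countable _) (by fun_prop)]
  simp only [ENat.toNat_natCast]
  rw [lintegral_one_sub_pow_poissonMeasure _ hc, ENNReal.coe_toNNReal hΛA]

lemma IsPoissonProcess.iIndepFun_count {ι : Type*} [Finite ι] (h : IsPoissonProcess Φ Λ μ)
    {A : ι → Set E} (hA : ∀ i, MeasurableSet (A i)) (hdisj : Pairwise (Disjoint on A)) :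
    iIndepFun (fun i => Φ.count (A i)) μ := by
  obtain ⟨k, ⟨e⟩⟩ := Finite.exists_equiv_fin ι
  have hFin := h.indep_count k (A ∘ e.symm) (fun i => hA _)
    fun i i' hii' => hdisj (e.symm.injective.ne hii')
  simpa using hFin.precomp e.injective

lemma IsPoissonProcess.lintegral_prod_one_sub_simpleFunc (h : IsPoissonProcess Φ Λ μ)
    {s : SimpleFunc E ℝ≥0∞} (hs1 : ∀ x, s x ≤ 1) (hs : s.FinMeasSupp Λ) :
    ∫⁻ ω, Φ.prod (fun x => 1 - s x) ω ∂μ = expNeg (∫⁻ x, s x ∂Λ) := by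
  have hΛ : ∀ c ≠ 0, Λ (s ⁻¹' {c}) ≠ ⊤ := fun c hc => (SimpleFunc.finMeasSupp_iff.1 hs c hc).ne
  have hcount : ∀ᵐ ω ∂μ, ∀ c ∈ s.range, c ≠ 0 → Φ.count (s ⁻¹' {c}) ω ≠ ⊤ := by
    rw [Filter.eventually_all_finset]
    exact fun c _ => eventually_imp_distrib_left.2 fun hc =>
      h.ae_count_ne_top (s.measurableSet_fiber c) (hΛ c hc)
  have hindep : iIndepFun (fun (c : s.range) ω =>
      (1 - (c : ℝ≥0∞)) ^ (Φ.count (s ⁻¹' {(c : ℝ≥0∞)}) ω).toNat) μ :=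
    (h.iIndepFun_count (fun c : s.range => s.measurableSet_fiber c) fun c c' hcc' =>
      Disjoint.preimage _ (disjoint_singleton.2 fun h => hcc' (Subtype.ext h))).comp
      (fun c k => (1 - (c : ℝ≥0∞)) ^ k.toNat) fun _ => measurable_of_countable _
  have hfactor : ∀ c : s.range,
      ∫⁻ ω, (1 - (c : ℝ≥0∞)) ^ (Φ.count (s ⁻¹' {(c : ℝ≥0∞)}) ω).toNat ∂μ =
        expNeg (c * Λ (s ⁻¹' {(c : ℝ≥0∞)})) := by
    rintro ⟨c, hc⟩
    obtain ⟨x, rfl⟩ := SimpleFunc.mem_range.1 hc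
    rcases eq_or_ne (s x) 0 with h0 | h0
    · have := hindep.isProbabilityMeasure
      simp [h0, expNeg_zero]
    · exact h.lintegral_one_sub_pow_count (s.measurableSet_fiber _) (hΛ _ h0) (hs1 x)
  rw [lintegral_congr_ae (hcount.mono fun ω hω => Φ.prod_one_sub_simpleFunc s hω)]
  simp_rw [← Finset.prod_coe_sort s.range]
  rw [lintegral_prod_eq_prod_lintegral_of_indepFun _ _ hindep fun c =>
      (measurable_of_countable fun k : ℕ∞ => (1 - (c : ℝ≥0∞)) ^ k.toNat).comp
        (h.measurable_count (s.measurableSet_fiber _)),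
    Finset.prod_congr rfl fun c _ => hfactor c, ← expNeg_sum,
    Finset.sum_coe_sort s.range fun c => c * Λ (s ⁻¹' {c}), SimpleFunc.lintegral_eq_lintegral,
    SimpleFunc.lintegral]

lemma exists_finMeasSupp_monotone_iSup_eq [SigmaFinite Λ] {u : E → ℝ≥0∞} (hu : Measurable u) :
    ∃ s : ℕ → SimpleFunc E ℝ≥0∞, (∀ k, (s k).FinMeasSupp Λ) ∧ (Monotone fun k x => s k x) ∧
      ∀ x, ⨆ k, s k x = u x := by
  let s : ℕ → SimpleFunc E ℝ≥0∞ := fun k => (SimpleFunc.eapprox u k).restrict (spanningSets Λ k)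
  have hs : ∀ k x, s k x = (spanningSets Λ k).indicator (SimpleFunc.eapprox u k) x :=
    fun k x => by rw [SimpleFunc.restrict_apply _ (measurableSet_spanningSets Λ k)]
  refine ⟨s, fun k => ?_, fun k l hkl x => ?_, fun x => ?_⟩
  · refine (measure_mono fun x hx => ?_).trans_lt (measure_spanningSets_lt_top Λ k)
    by_contra hxk
    exact hx ((hs k x).trans (indicator_of_notMem hxk _))
  · simp only [hs]
    exact (indicator_le_indicator (SimpleFunc.monotone_eapprox u hkl x)).trans
      (indicator_le_indicator_of_subset (monotone_spanningSets Λ hkl) (fun _ => zero_le) x)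
  · rw [← SimpleFunc.iSup_eapprox_apply hu x]
    refine le_antisymm (iSup_mono fun k => (hs k x).trans_le (indicator_le_self _ _ x))
      (iSup_le fun k => le_iSup_of_le (max k (spanningSetsIndex Λ x)) ?_)
    rw [hs, indicator_of_mem
      (monotone_spanningSets Λ (le_max_right _ _) (mem_spanningSetsIndex Λ x))]
    exact SimpleFunc.monotone_eapprox u (le_max_left _ _) x

theorem IsPoissonProcess.lintegral_prod_one_sub [SigmaFinite Λ] (h : IsPoissonProcess Φ Λ μ)
    {u : E → ℝ≥0∞} (hu : Measurable u) (hu1 : ∀ x, u x ≤ 1) :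
    ∫⁻ ω, Φ.prod (fun x => 1 - u x) ω ∂μ = expNeg (∫⁻ x, u x ∂Λ) := by
  obtain ⟨s, hs, hmono, hsup⟩ := exists_finMeasSupp_monotone_iSup_eq (Λ := Λ) hu
  have hs1 : ∀ k x, s k x ≤ 1 := fun k x =>
    (le_iSup (fun k => s k x) k).trans ((hsup x).trans_le (hu1 x))
  have hsimple : ∀ k, ∫⁻ ω, Φ.prod (fun x => 1 - s k x) ω ∂μ = expNeg (∫⁻ x, s k x ∂Λ) :=
    fun k => h.lintegral_prod_one_sub_simpleFunc (hs1 k) (hs k)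
  have hanti : Antitone fun k => Φ.prod (fun x => 1 - s k x) := fun k l hkl =>
    Φ.prod_mono (fun x => tsub_le_tsub_left (hmono hkl x) 1) fun _ => tsub_le_self
  have hlim : Tendsto (fun k => expNeg (∫⁻ x, s k x ∂Λ)) atTop (𝓝 (expNeg (∫⁻ x, u x ∂Λ))) := by
    simp_rw [← hsup]
    rw [lintegral_iSup (fun k => (s k).measurable) hmono]
    exact (continuous_expNeg.tendsto _).comp
      (tendsto_atTop_iSup fun k l hkl => lintegral_mono (hmono hkl))
  simp_rw [← hsup, Φ.prod_one_sub_iSup hmono]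
  simp_rw [hsup]
  rw [lintegral_iInf (fun k => h.measurable_prod (by fun_prop) fun x => tsub_le_self) hanti]
  · simp_rw [hsimple]
    refine tendsto_nhds_unique (tendsto_atTop_iInf ?_) hlim
    simp_rw [← hsimple]
    exact fun k l hkl => lintegral_mono (hanti hkl)
  · rw [hsimple]
    exact expNeg_ne_top _

/-! ### Void probabilities of an independently marked Poisson process -/

/-- The event that the marked point process has no point in `T`. -/
def RandomPoints.voidEvent (Φ : RandomPoints Ω E) (χ : ℕ → Ω → ℝ) (T : Set (E × ℝ)) : Set Ω :=
  {ω | ∀ n : ℕ, (n : ℕ∞) < Φ.num ω → (Φ.pt n ω, χ n ω) ∉ T}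

variable {χ : ℕ → Ω → ℝ} {ν : Measure ℝ} {T : Set (E × ℝ)}

lemma IsIndepMarking.isProbabilityMeasure (hχ : IsIndepMarking Φ χ ν μ) :
    IsProbabilityMeasure ν := by
  have := hχ.iIndep_mark.isProbabilityMeasure
  exact hχ.map_mark 0 ▸ Measure.isProbabilityMeasure_map (hχ.measurable_mark 0).aemeasurable

lemma IsIndepMarking.map_marks (hχ : IsIndepMarking Φ χ ν μ) :
    μ.map (fun ω n => χ n ω) = Measure.infinitePi fun _ => ν := by
  rw [hχ.iIndep_mark.map_fun_eq_infinitePi_map hχ.measurable_mark]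
  simp_rw [hχ.map_mark]

lemma IsPoissonProcess.measurableSet_voidEvent (hΦ : IsPoissonProcess Φ Λ μ)
    (hχ : IsIndepMarking Φ χ ν μ) (hT : MeasurableSet T) :
    MeasurableSet (Φ.voidEvent χ T) := by
  simp only [RandomPoints.voidEvent, ofPred_forall]
  exact .iInter fun n => (hΦ.measurableSet_lt_num n).imp
    ((hΦ.measurable_pt n).prodMk (hχ.measurable_mark n) hT).compl

omit [MeasurableSpace Ω] in
lemma RandomPoints.infinitePi_forall_notMem (Φ : RandomPoints Ω E) [IsProbabilityMeasure ν]
    (hT : MeasurableSet T) (ω : Ω) :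
    Measure.infinitePi (fun _ : ℕ => ν)
        {y | ∀ n : ℕ, (n : ℕ∞) < Φ.num ω → (Φ.pt n ω, y n) ∉ T} =
      Φ.prod (fun x => 1 - ν (Prod.mk x ⁻¹' T)) ω := by
  classical
  let C : ℕ → Set ℝ := fun n =>
    if (n : ℕ∞) < Φ.num ω then (Prod.mk (Φ.pt n ω) ⁻¹' T)ᶜ else univ
  have hTn : ∀ n, MeasurableSet (Prod.mk (Φ.pt n ω) ⁻¹' T) := fun n => measurable_prodMk_left hT
  have hC : ∀ n, MeasurableSet (C n) := fun n => by
    by_cases hn : (n : ℕ∞) < Φ.num ω <;> simp [C, hn, (hTn n).compl]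
  have hpi : {y : ℕ → ℝ | ∀ n : ℕ, (n : ℕ∞) < Φ.num ω → (Φ.pt n ω, y n) ∉ T} = univ.pi C := by
    ext y
    refine forall_congr' fun n => ?_
    by_cases hn : (n : ℕ∞) < Φ.num ω <;> simp [C, hn]
  rw [hpi, Measure.infinitePi_pi_univ _ hC, RandomPoints.prod]
  refine tprod_congr fun n => ?_
  by_cases hn : (n : ℕ∞) < Φ.num ω <;> simp [C, hn, mulIndicator, prob_compl_eq_one_sub (hTn n)]

lemma IsPoissonProcess.measure_voidEvent_eq_lintegral (hΦ : IsPoissonProcess Φ Λ μ)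
    (hχ : IsIndepMarking Φ χ ν μ) (hT : MeasurableSet T) :
    μ (Φ.voidEvent χ T) = ∫⁻ ω, Φ.prod (fun x => 1 - ν (Prod.mk x ⁻¹' T)) ω ∂μ := by
  have := hχ.isProbabilityMeasure
  let X : Ω → ℕ∞ × (ℕ → E) := fun ω => (Φ.num ω, fun n => Φ.pt n ω)
  let Y : Ω → ℕ → ℝ := fun ω n => χ n ω
  have hX : Measurable X := hΦ.measurable_num.prodMk (measurable_pi_lambda _ hΦ.measurable_pt)
  have hY : Measurable Y := measurable_pi_lambda _ hχ.measurable_mark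
  let S : Set ((ℕ∞ × (ℕ → E)) × (ℕ → ℝ)) :=
    {z | ∀ n : ℕ, (n : ℕ∞) < z.1.1 → (z.1.2 n, z.2 n) ∉ T}
  have hS : MeasurableSet S := by
    simp only [S, ofPred_forall]
    refine .iInter fun n => .imp ?_ (.compl ?_)
    · exact measurable_fst.fst (MeasurableSet.of_discrete (s := Ioi (n : ℕ∞)))
    · exact ((measurable_pi_apply n).comp measurable_fst.snd).prodMk
        ((measurable_pi_apply n).comp measurable_snd) hT
  have hXY : μ.map (fun ω => (X ω, Y ω)) = (μ.map X).prod (Measure.infinitePi fun _ => ν) := by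
    rw [← hχ.map_marks]
    have := hχ.iIndep_mark.isProbabilityMeasure
    exact (indepFun_iff_map_prod_eq_prod_map_map hX.aemeasurable hY.aemeasurable).1 hχ.indep_points
  change μ ((fun ω => (X ω, Y ω)) ⁻¹' S) = _
  rw [← Measure.map_apply (hX.prodMk hY) hS, hXY, Measure.prod_apply hS,
    lintegral_map (measurable_measure_prodMk_left hS) hX]
  exact lintegral_congr fun ω => Φ.infinitePi_forall_notMem hT ω

theorem IsPoissonProcess.measure_voidEvent [SigmaFinite Λ] (hΦ : IsPoissonProcess Φ Λ μ)
    (hχ : IsIndepMarking Φ χ ν μ) (hT : MeasurableSet T) :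
    μ (Φ.voidEvent χ T) = expNeg (Λ.prod ν T) := by
  have := hχ.isProbabilityMeasure
  rw [hΦ.measure_voidEvent_eq_lintegral hχ hT, Measure.prod_apply hT,
    hΦ.lintegral_prod_one_sub (measurable_measure_prodMk_left hT) fun _ => prob_le_one]

lemma IsPoissonProcess.ae_exists_mem_voidEvent [SigmaFinite Λ] (hΦ : IsPoissonProcess Φ Λ μ)
    (hχ : IsIndepMarking Φ χ ν μ) {A : ℕ → Set (E × ℝ)} (hA : ∀ k, MeasurableSet (A k))
    (hlim : Tendsto (fun k => Λ.prod ν (A k)) atTop (𝓝 0)) :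
    ∀ᵐ ω ∂μ, ∃ k, ω ∈ Φ.voidEvent χ (A k) := by
  have := hχ.iIndep_mark.isProbabilityMeasure
  have hvoid : Tendsto (fun k => μ (Φ.voidEvent χ (A k))) atTop (𝓝 1) := by
    simp_rw [hΦ.measure_voidEvent hχ (hA _)]
    exact expNeg_zero ▸ (continuous_expNeg.tendsto 0).comp hlim
  have hmeas : MeasurableSet (⋃ k, Φ.voidEvent χ (A k)) :=
    .iUnion fun k => hΦ.measurableSet_voidEvent hχ (hA k)
  have hunion : μ (⋃ k, Φ.voidEvent χ (A k)) = 1 :=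
    le_antisymm prob_le_one (le_of_tendsto' hvoid fun k =>
      measure_mono (subset_iUnion (fun k => Φ.voidEvent χ (A k)) k))
  filter_upwards [(prob_compl_eq_zero_iff hmeas).2 hunion |> compl_mem_ae_iff.2] with ω hω
  simpa using hω

theorem IsPoissonProcess.ae_finite [SigmaFinite Λ] (hΦ : IsPoissonProcess Φ Λ μ)
    (hχ : IsIndepMarking Φ χ ν μ) (hT : MeasurableSet T) (hΛT : Λ.prod ν T ≠ ⊤) :
    ∀ᵐ ω ∂μ, {n : ℕ | (n : ℕ∞) < Φ.num ω ∧ (Φ.pt n ω, χ n ω) ∈ T}.Finite := by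
  let A : ℕ → Set (E × ℝ) := fun k => T ∩ (spanningSets Λ k)ᶜ ×ˢ univ
  have hA : ∀ k, MeasurableSet (A k) := fun k =>
    hT.inter ((measurableSet_spanningSets Λ k).compl.prod .univ)
  have hAanti : Antitone A := fun k l hkl => inter_subset_inter_right _
    (prod_mono_left (compl_subset_compl.2 (monotone_spanningSets Λ hkl)))
  have hA_empty : ⋂ k, A k = ∅ := eq_empty_of_forall_notMem fun z hz =>
    (mem_iInter.1 hz (spanningSetsIndex Λ z.1)).2.1 (mem_spanningSetsIndex Λ z.1)
  have hlim : Tendsto (fun k => Λ.prod ν (A k)) atTop (𝓝 0) := by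
    have h := tendsto_measure_iInter_atTop (μ := Λ.prod ν) (fun k => (hA k).nullMeasurableSet)
      hAanti ⟨0, ne_top_of_le_ne_top hΛT (measure_mono inter_subset_left)⟩
    rwa [hA_empty, measure_empty] at h
  have hcount : ∀ᵐ ω ∂μ, ∀ k, Φ.count (spanningSets Λ k) ω ≠ ⊤ := ae_all_iff.2 fun k =>
    hΦ.ae_count_ne_top (measurableSet_spanningSets Λ k) (measure_spanningSets_lt_top Λ k).ne
  filter_upwards [hΦ.ae_exists_mem_voidEvent hχ hA hlim, hcount] with ω ⟨k, hk⟩ hω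
  have hfin := hω k
  rw [RandomPoints.count, Ne, encard_eq_top_iff, not_infinite] at hfin
  refine hfin.subset fun n hn => ⟨hn.1, ?_⟩
  by_contra hnk
  exact hk n hn.1 ⟨hn.2, hnk, mem_univ _⟩

/-! ### The smallest value at the points of a marked Poisson process -/

/-- The values of `ℓ` at the marked points of `Φ`; the propagation process is the case where `ℓ` is
the propagation loss. -/
def RandomPoints.markedImage (Φ : RandomPoints Ω E) (χ : ℕ → Ω → ℝ) (ℓ : E × ℝ → ℝ) (ω : Ω) :
    Set ℝ :=
  {l | ∃ n : ℕ, (n : ℕ∞) < Φ.num ω ∧ l = ℓ (Φ.pt n ω, χ n ω)}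

variable {ℓ : E × ℝ → ℝ} {s : Set ℝ}

omit [MeasurableSpace Ω] [MeasurableSpace E] in
lemma RandomPoints.setOf_markedImage_inter_nonempty (Φ : RandomPoints Ω E) :
    {ω | (Φ.markedImage χ ℓ ω ∩ s).Nonempty} = (Φ.voidEvent χ (ℓ ⁻¹' s))ᶜ := by
  ext ω
  simp [markedImage, voidEvent, Set.Nonempty]

omit [MeasurableSpace Ω] [MeasurableSpace E] in
lemma RandomPoints.bddBelow_markedImage (Φ : RandomPoints Ω E) (hℓ : BddBelow (range ℓ)) (ω : Ω) :
    BddBelow (Φ.markedImage χ ℓ ω) :=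
  hℓ.mono (by rintro _ ⟨n, _, rfl⟩; exact mem_range_self _)

lemma IsPoissonProcess.measurableSet_markedImage_inter_nonempty (hΦ : IsPoissonProcess Φ Λ μ)
    (hχ : IsIndepMarking Φ χ ν μ) (hℓ : Measurable ℓ) (hs : MeasurableSet s) :
    MeasurableSet {ω | (Φ.markedImage χ ℓ ω ∩ s).Nonempty} := by
  rw [Φ.setOf_markedImage_inter_nonempty]
  exact (hΦ.measurableSet_voidEvent hχ (hℓ hs)).compl

lemma IsPoissonProcess.measurableSet_markedImage_nonempty (hΦ : IsPoissonProcess Φ Λ μ)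
    (hχ : IsIndepMarking Φ χ ν μ) (hℓ : Measurable ℓ) :
    MeasurableSet {ω | (Φ.markedImage χ ℓ ω).Nonempty} := by
  simpa only [inter_univ] using hΦ.measurableSet_markedImage_inter_nonempty hχ hℓ .univ

theorem IsPoissonProcess.measure_markedImage_inter_nonempty [SigmaFinite Λ]
    (hΦ : IsPoissonProcess Φ Λ μ) (hχ : IsIndepMarking Φ χ ν μ) (hℓ : Measurable ℓ)
    (hs : MeasurableSet s) :
    μ {ω | (Φ.markedImage χ ℓ ω ∩ s).Nonempty} = 1 - expNeg (Λ.prod ν (ℓ ⁻¹' s)) := by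
  have := hχ.iIndep_mark.isProbabilityMeasure
  rw [Φ.setOf_markedImage_inter_nonempty,
    prob_compl_eq_one_sub (hΦ.measurableSet_voidEvent hχ (hℓ hs)),
    hΦ.measure_voidEvent hχ (hℓ hs)]

theorem IsPoissonProcess.measure_markedImage_nonempty [SigmaFinite Λ]
    (hΦ : IsPoissonProcess Φ Λ μ) (hχ : IsIndepMarking Φ χ ν μ) (hℓ : Measurable ℓ) :
    μ {ω | (Φ.markedImage χ ℓ ω).Nonempty} = 1 - expNeg (Λ univ) := by
  have := hχ.isProbabilityMeasure
  simpa [← univ_prod_univ] using hΦ.measure_markedImage_inter_nonempty hχ hℓ .univ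

lemma IsPoissonProcess.measurable_sInf_markedImage (hΦ : IsPoissonProcess Φ Λ μ)
    (hχ : IsIndepMarking Φ χ ν μ) (hℓ : Measurable ℓ) (hbdd : BddBelow (range ℓ)) :
    Measurable fun ω => sInf (Φ.markedImage χ ℓ ω) := by
  refine measurable_of_Iio fun t => ?_
  have hpre : (fun ω => sInf (Φ.markedImage χ ℓ ω)) ⁻¹' Iio t =
      {ω | (Φ.markedImage χ ℓ ω ∩ Iio t).Nonempty} ∪
        ({ω | (Φ.markedImage χ ℓ ω).Nonempty}ᶜ ∩ {_ω | 0 < t}) := by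
    ext ω
    rcases (Φ.markedImage χ ℓ ω).eq_empty_or_nonempty with h | h
    · simp [h]
    · simp [h, csInf_lt_iff (Φ.bddBelow_markedImage hbdd ω) h, inter_nonempty]
  rw [hpre]
  exact (hΦ.measurableSet_markedImage_inter_nonempty hχ hℓ measurableSet_Iio).union
    ((hΦ.measurableSet_markedImage_nonempty hχ hℓ).compl.inter (.const _))

lemma isLeast_csInf_of_finite_inter_Iic {α : Type*} [ConditionallyCompleteLinearOrder α]
    {S : Set α} (hne : S.Nonempty) (hfin : ∀ t, (S ∩ Iic t).Finite) : IsLeast S (sInf S) := by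
  obtain ⟨x, hx⟩ := hne
  obtain ⟨y, ⟨hyS, hyx⟩, hy⟩ := (S ∩ Iic x).exists_min_image id (hfin x) ⟨x, hx, le_rfl⟩
  have hleast : IsLeast S y := ⟨hyS, fun z hz =>
    (le_total z x).elim (fun hzx => hy z ⟨hz, hzx⟩) hyx.trans⟩
  rwa [hleast.csInf_eq]

theorem IsPoissonProcess.ae_isLeast_sInf_markedImage [SigmaFinite Λ]
    (hΦ : IsPoissonProcess Φ Λ μ) (hχ : IsIndepMarking Φ χ ν μ) (hℓ : Measurable ℓ)
    (hfin : ∀ t, Λ.prod ν (ℓ ⁻¹' Iic t) ≠ ⊤) :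
    ∀ᵐ ω ∂μ, (Φ.markedImage χ ℓ ω).Nonempty →
      IsLeast (Φ.markedImage χ ℓ ω) (sInf (Φ.markedImage χ ℓ ω)) := by
  have hnat : ∀ᵐ ω ∂μ, ∀ k : ℕ, {n : ℕ | (n : ℕ∞) < Φ.num ω ∧
      (Φ.pt n ω, χ n ω) ∈ ℓ ⁻¹' Iic (k : ℝ)}.Finite :=
    ae_all_iff.2 fun k => hΦ.ae_finite hχ (hℓ measurableSet_Iic) (hfin k)
  filter_upwards [hnat] with ω hω hne
  refine isLeast_csInf_of_finite_inter_Iic hne fun t => ?_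
  obtain ⟨k, hk⟩ := exists_nat_ge t
  refine ((hω k).image fun n => ℓ (Φ.pt n ω, χ n ω)).subset ?_
  rintro _ ⟨⟨n, hn, rfl⟩, hnt⟩
  exact ⟨n, ⟨hn, hnt.trans hk⟩, rfl⟩

theorem IsPoissonProcess.measure_sInf_markedImage_le [SigmaFinite Λ]
    (hΦ : IsPoissonProcess Φ Λ μ) (hχ : IsIndepMarking Φ χ ν μ) (hℓ : Measurable ℓ)
    (hbdd : BddBelow (range ℓ)) (hfin : ∀ t, Λ.prod ν (ℓ ⁻¹' Iic t) ≠ ⊤) (t : ℝ) :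
    μ {ω | (Φ.markedImage χ ℓ ω).Nonempty ∧ sInf (Φ.markedImage χ ℓ ω) ≤ t} =
      1 - expNeg (Λ.prod ν (ℓ ⁻¹' Iic t)) := by
  rw [← hΦ.measure_markedImage_inter_nonempty hχ hℓ measurableSet_Iic]
  refine measure_congr ?_
  filter_upwards [hΦ.ae_isLeast_sInf_markedImage hχ hℓ hfin] with ω hω
  refine propext ⟨fun ⟨hne, hle⟩ => ⟨_, (hω hne).1, hle⟩, fun ⟨l, hl, hlt⟩ => ?_⟩
  exact ⟨⟨l, hl⟩, (csInf_le (Φ.bddBelow_markedImage hbdd ω) hl).trans hlt⟩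

end Poisson

/-! ### Densities of laws with a differentiable distribution function -/

lemma measure_Ioi_eq_ofReal_one_sub_cdf (ρ : Measure ℝ) [IsProbabilityMeasure ρ] (b : ℝ) :
    ρ (Ioi b) = ENNReal.ofReal (1 - cdf ρ b) := by
  rw [← compl_Iic, prob_compl_eq_one_sub measurableSet_Iic, ← ofReal_cdf,
    ENNReal.ofReal_sub _ (cdf_nonneg ρ b), ENNReal.ofReal_one]

section Density

variable {ρ : Measure ℝ} [IsProbabilityMeasure ρ] {a : ℝ} {g : ℝ → ℝ}

lemma setLIntegral_Ioi_deriv_cdf (hg : ∀ t > a, HasDerivAt (cdf ρ) (g t) t) {b : ℝ} (hab : a ≤ b) :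
    ∫⁻ t in Ioi b, ENNReal.ofReal (g t) = ρ (Ioi b) := by
  have hderiv : ∀ t ∈ Ioi b, HasDerivAt (cdf ρ) (g t) t := fun t ht => hg t (hab.trans_lt ht)
  have hcont : ContinuousWithinAt (cdf ρ) (Ici b) b := (cdf ρ).right_continuous b
  have hg0 : ∀ t ∈ Ioi b, 0 ≤ g t := fun t ht => (hderiv t ht).nonneg_of_monotone (monotone_cdf ρ)
  have hlim := tendsto_cdf_atTop ρ
  rw [← ofReal_integral_eq_lintegral_ofReal
      (integrableOn_Ioi_deriv_of_nonneg hcont hderiv hg0 hlim)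
      (ae_restrict_of_forall_mem measurableSet_Ioi hg0),
    integral_Ioi_of_hasDerivAt_of_nonneg hcont hderiv hg0 hlim,
    measure_Ioi_eq_ofReal_one_sub_cdf]

theorem eq_withDensity_of_hasDerivAt_cdf (hg : ∀ t > a, HasDerivAt (cdf ρ) (g t) t)
    (ha : ρ (Iic a) = 0) :
    ρ = (volume.restrict (Ioi a)).withDensity fun t => ENNReal.ofReal (g t) := by
  have hIoi : ρ (Ioi a) = 1 := by
    rw [← compl_Iic, prob_compl_eq_one_sub measurableSet_Iic, ha, tsub_zero]
  have huniv : ρ univ = ∫⁻ t in Ioi a, ENNReal.ofReal (g t) := by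
    rw [measure_univ, setLIntegral_Ioi_deriv_cdf hg le_rfl, hIoi]
  refine ext_of_generate_finite _ (borel_eq_generateFrom_Ioi ℝ) isPiSystem_Ioi ?_ ?_
  · rintro _ ⟨b, rfl⟩
    rw [withDensity_apply _ measurableSet_Ioi, Measure.restrict_restrict measurableSet_Ioi,
      Ioi_inter_Ioi, setLIntegral_Ioi_deriv_cdf hg (le_max_right b a)]
    rcases le_total a b with hab | hba
    · rw [max_eq_left hab]
    · rw [max_eq_right hba, hIoi]
      exact le_antisymm prob_le_one (hIoi ▸ measure_mono (Ioi_subset_Ioi hba))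
  · rw [huniv, withDensity_apply _ .univ, Measure.restrict_univ]

end Density

/-! ### The Gaussian tail -/

lemma gaussianPDFReal_zero_one (x : ℝ) :
    gaussianPDFReal 0 1 x = (√(2 * Real.pi))⁻¹ * Real.exp (-x ^ 2 / 2) := by
  simp [gaussianPDFReal]

lemma continuous_gaussianPDFReal_zero_one : Continuous (gaussianPDFReal 0 1) := by
  simp_rw [funext gaussianPDFReal_zero_one]
  fun_prop

lemma Q_eq_integral (x : ℝ) : Q x = ∫ y in Ioi x, gaussianPDFReal 0 1 y := by
  rw [Q, Measure.real, gaussianReal_apply_eq_integral 0 one_ne_zero, ENNReal.toReal_ofReal]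
  exact integral_nonneg fun y => gaussianPDFReal_nonneg 0 1 y

lemma hasDerivAt_Q (x : ℝ) : HasDerivAt Q (-gaussianPDFReal 0 1 x) x := by
  have hint : Integrable (gaussianPDFReal 0 1) := integrable_gaussianPDFReal 0 1
  have hQ : Q = fun x => Q 0 - ∫ y in (0 : ℝ)..x, gaussianPDFReal 0 1 y := by
    funext x
    rw [Q_eq_integral, Q_eq_integral,
      ← intervalIntegral.integral_Ioi_sub_Ioi' hint.integrableOn hint.integrableOn, sub_sub_cancel]
  rw [hQ]
  exact (intervalIntegral.integral_hasDerivAt_right hint.intervalIntegrable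
    continuous_gaussianPDFReal_zero_one.stronglyMeasurable.stronglyMeasurableAtFilter
    continuous_gaussianPDFReal_zero_one.continuousAt).const_sub _

lemma gaussianReal_real_Iio (a u : ℝ) : (gaussianReal a 1).real (Iio u) = Q (a - u) := by
  have h := gaussianReal_map_const_sub (μ := 0) (v := 1) a
  rw [sub_zero] at h
  rw [← h, map_measureReal_apply (by fun_prop) measurableSet_Iio, Q]
  simp

lemma exp_mul_gaussianPDFReal (a z : ℝ) :
    gaussianPDFReal 0 1 z * Real.exp (a * z) =
      Real.exp (a ^ 2 / 2) * gaussianPDFReal a 1 z := by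
  rw [gaussianPDFReal_zero_one, gaussianPDFReal, mul_assoc, ← Real.exp_add, mul_left_comm,
    ← Real.exp_add, NNReal.coe_one]
  ring_nf

lemma setIntegral_exp_mul_gaussianReal (a u : ℝ) :
    ∫ z in Iio u, Real.exp (a * z) ∂(gaussianReal 0 1) = Real.exp (a ^ 2 / 2) * Q (a - u) := by
  rw [← gaussianReal_real_Iio, ← integral_indicator_one measurableSet_Iio,
    integral_gaussianReal_eq_integral_smul one_ne_zero, ← integral_const_mul,
    ← integral_indicator measurableSet_Iio, integral_gaussianReal_eq_integral_smul one_ne_zero]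
  refine integral_congr_ae (ae_of_all _ fun z => ?_)
  by_cases hz : z ∈ Iio u <;> simp [hz, exp_mul_gaussianPDFReal]

lemma integral_exp_mul_gaussianReal (a : ℝ) :
    ∫ z, Real.exp (a * z) ∂(gaussianReal 0 1) = Real.exp (a ^ 2 / 2) := by
  simpa [mgf] using congrFun (mgf_fun_id_gaussianReal (μ := 0) (v := 1)) a

/-! ### Derivatives of the explicit functions -/

section Params

variable {P : Params} {j : LinkType} {t : ℝ}

lemma sigma_pos (hxi : 0 < P.xi j) : 0 < sigma P j := by
  have := Real.log_pos (show (1 : ℝ) < 10 by norm_num)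
  unfold sigma
  positivity

lemma hasDerivAt_Upsilon (hD : 0 < P.D) (ht : 0 < t) :
    HasDerivAt (Upsilon P j) (-(1 / (t * sigma P j))) t := by
  have hDa : P.D ^ P.alpha j ≠ 0 := (Real.rpow_pos_of_pos hD _).ne'
  have h : HasDerivAt (fun t => ((Real.log (P.D ^ P.alpha j) - Real.log t) - m P) / sigma P j)
      ((-t⁻¹) / sigma P j) t :=
    (((Real.hasDerivAt_log ht.ne').const_sub _).sub_const _).div_const _
  refine (h.congr_of_eventuallyEq ?_).congr_deriv ?_
  · filter_upwards [lt_mem_nhds ht] with s hs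
    rw [Upsilon, Real.log_div hDa hs.ne']
  · rw [neg_div, inv_eq_one_div, div_div]

lemma edgeTerm_eq (t : ℝ) :
    edgeTerm P j t = P.D ^ 2 * (gaussianPDFReal 0 1 (Upsilon P j t) / (t * sigma P j)) := by
  rw [edgeTerm, gaussianPDFReal_zero_one]
  simp only [div_eq_mul_inv, mul_inv]
  ring

lemma hasDerivAt_sq_mul_Q_Upsilon (hD : 0 < P.D) (ht : 0 < t) :
    HasDerivAt (fun t => P.D ^ 2 * Q (Upsilon P j t)) (edgeTerm P j t) t := by
  refine (((hasDerivAt_Q _).comp t (hasDerivAt_Upsilon hD ht)).const_mul _).congr_deriv ?_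
  rw [edgeTerm_eq]
  ring

lemma gaussTerm_eq (hs : 0 < sigma P j) (t : ℝ) :
    gaussTerm P j t = gaussianPDFReal 0 1
      (2 * sigma P j ^ 2 / (P.alpha j * sigma P j) - Upsilon P j t) / sigma P j := by
  have h2 : (√2 : ℝ) ^ 2 = 2 := Real.sq_sqrt zero_le_two
  have hsq : (√2 * sigma P j / P.alpha j - Upsilon P j t / √2) ^ 2 =
      (2 * sigma P j ^ 2 / (P.alpha j * sigma P j) - Upsilon P j t) ^ 2 / 2 := by
    rw [pow_two (sigma P j), ← mul_assoc 2, mul_div_mul_right _ _ hs.ne']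
    nth_rw 3 4 [← h2]
    field_simp
  rw [gaussTerm, hsq, gaussianPDFReal_zero_one, Real.sqrt_mul (by positivity), Real.sqrt_sq hs.le,
    neg_div]
  field_simp

lemma hasDerivAt_qShift (hD : 0 < P.D) (hs : 0 < sigma P j) (ht : 0 < t) :
    HasDerivAt (qShift P j) (-(gaussTerm P j t / t)) t := by
  refine ((hasDerivAt_Q _).comp t ((hasDerivAt_Upsilon hD ht).const_sub _)).congr_deriv ?_
  rw [gaussTerm_eq hs]
  field_simp

/-- The mean of `min (R ^ 2) (D ^ 2)`, where `R` is the random distance within which the loss is at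
most `t`: the common ingredient of `M_L` and `M_N` (see `integral_min_coverRadius_sq`). -/
noncomputable def truncSqMean (P : Params) (j : LinkType) (t : ℝ) : ℝ :=
  P.D ^ 2 * Q (Upsilon P j t) + t ^ (2 / P.alpha j) * expConst P j * qShift P j t

lemma M_LOS (P : Params) (t : ℝ) : M P .LOS t = Real.pi * P.p * truncSqMean P .LOS t := rfl

lemma M_NLOS (P : Params) (t : ℝ) :
    M P .NLOS t = Real.pi * (t ^ (2 / P.alpha .NLOS) * expConst P .NLOS) -
      Real.pi * P.p * truncSqMean P .NLOS t := by
  rw [M, truncSqMean]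
  ring

lemma hasDerivAt_truncSqMean (hD : 0 < P.D) (hs : 0 < sigma P j) (ht : 0 < t) :
    HasDerivAt (truncSqMean P j)
      (edgeTerm P j t + expConst P j * t ^ (2 / P.alpha j - 1) *
        (2 / P.alpha j * qShift P j t - gaussTerm P j t)) t := by
  have hpow : t ^ (2 / P.alpha j) = t ^ (2 / P.alpha j - 1) * t := by
    rw [Real.rpow_sub_one ht.ne', div_mul_cancel₀ _ ht.ne']
  refine ((hasDerivAt_sq_mul_Q_Upsilon hD ht).add
    (((Real.hasDerivAt_rpow_const (Or.inl ht.ne')).mul_const _).mul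
      (hasDerivAt_qShift hD hs ht))).congr_deriv ?_
  rw [hpow]
  field_simp
  ring

theorem hasDerivAt_M (hp : P.p ≠ 0) (hD : 0 < P.D) (hxi : 0 < P.xi j) (ht : 0 < t) :
    HasDerivAt (M P j) (M' P j t) t := by
  have htrunc := (hasDerivAt_truncSqMean hD (sigma_pos hxi) ht).const_mul (Real.pi * P.p)
  cases j with
  | LOS =>
    refine htrunc.congr_deriv ?_
    rw [M', add_comm (edgeTerm P .LOS t)]
  | NLOS =>
    rw [funext (M_NLOS P)]
    refine ((((Real.hasDerivAt_rpow_const (Or.inl ht.ne')).mul_const _).const_mul _).sub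
      htrunc).congr_deriv ?_
    rw [M', ← div_div, div_right_comm]
    linear_combination (-(Real.pi * expConst P .NLOS * t ^ (2 / P.alpha .NLOS - 1)) : ℝ) *
      mul_div_cancel₀ (2 / P.alpha .NLOS) hp

end Params

/-! ### The intensity of the base stations -/

section Intensity

variable {P : Params}

instance (P : Params) (j : LinkType) : SigmaFinite (intensity P j) :=
  SigmaFinite.withDensity_ofReal _

lemma measurable_density (P : Params) (j : LinkType) : Measurable (density P j) := by
  have hD : MeasurableSet {x : Plane | ‖x‖ ≤ P.D} :=
    measurableSet_le measurable_norm measurable_const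
  cases j <;> exact .ite hD measurable_const measurable_const

lemma volume_closedBall_plane {r : ℝ} (hr : 0 ≤ r) :
    volume (Metric.closedBall (0 : Plane) r) = ENNReal.ofReal (Real.pi * r ^ 2) := by
  rw [EuclideanSpace.volume_closedBall_fin_two, ← ENNReal.ofReal_pow hr,
    ← ENNReal.ofReal_mul (by positivity), mul_comm]

lemma intensity_LOS (P : Params) :
    intensity P .LOS =
      ENNReal.ofReal (P.lam * P.p) • volume.restrict (Metric.closedBall 0 P.D) := by
  rw [← withDensity_const, ← withDensity_indicator Metric.isClosed_closedBall.measurableSet,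
    intensity]
  congr 1 with x
  by_cases hx : ‖x‖ ≤ P.D <;> simp [density, hx]

lemma intensity_LOS_add_intensity_NLOS (hlam : 0 ≤ P.lam) (hp : 0 ≤ P.p) (hp1 : P.p ≤ 1) :
    intensity P .LOS + intensity P .NLOS = ENNReal.ofReal P.lam • volume := by
  rw [intensity, intensity, ← withDensity_const,
    ← withDensity_add_left (measurable_density P .LOS).ennreal_ofReal]
  congr 1 with x
  by_cases hx : ‖x‖ ≤ P.D
  · simp only [Pi.add_apply, density, hx, if_true]
    rw [← ENNReal.ofReal_add (by positivity) (mul_nonneg hlam (sub_nonneg.2 hp1)), ← mul_add,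
      add_sub_cancel, mul_one]
  · simp [density, hx]

/-- Mean number of base stations of type `j` within distance `r` of the origin, divided by `λ`. -/
noncomputable def diskMean (P : Params) : LinkType → ℝ → ℝ
  | .LOS, r => Real.pi * P.p * min r P.D ^ 2
  | .NLOS, r => Real.pi * r ^ 2 - Real.pi * P.p * min r P.D ^ 2

lemma diskMean_nonneg (hp : 0 ≤ P.p) (hp1 : P.p ≤ 1) (hD : 0 ≤ P.D) (j : LinkType) {r : ℝ}
    (hr : 0 ≤ r) : 0 ≤ diskMean P j r := by
  cases j with
  | LOS => rw [diskMean]; positivity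
  | NLOS =>
    have hmin : min r P.D ^ 2 ≤ r ^ 2 := pow_le_pow_left₀ (le_min hr hD) (min_le_left _ _) 2
    rw [diskMean, mul_assoc, ← mul_sub]
    exact mul_nonneg Real.pi_pos.le (sub_nonneg.2
      ((mul_le_of_le_one_left (sq_nonneg _) hp1).trans hmin))

lemma intensity_LOS_closedBall (hlam : 0 ≤ P.lam) (hp : 0 ≤ P.p) (hD : 0 ≤ P.D) {r : ℝ}
    (hr : 0 ≤ r) :
    intensity P .LOS (Metric.closedBall 0 r) = ENNReal.ofReal (P.lam * diskMean P .LOS r) := by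
  have hinter : Metric.closedBall (0 : Plane) r ∩ Metric.closedBall 0 P.D =
      Metric.closedBall 0 (min r P.D) := by
    ext x
    simp
  rw [intensity_LOS, Measure.smul_apply,
    Measure.restrict_apply Metric.isClosed_closedBall.measurableSet, hinter,
    volume_closedBall_plane (le_min hr hD), smul_eq_mul, ← ENNReal.ofReal_mul (by positivity),
    diskMean]
  ring_nf

lemma intensity_closedBall (hlam : 0 ≤ P.lam) (hp : 0 ≤ P.p) (hp1 : P.p ≤ 1) (hD : 0 ≤ P.D)
    (j : LinkType) {r : ℝ} (hr : 0 ≤ r) :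
    intensity P j (Metric.closedBall 0 r) = ENNReal.ofReal (P.lam * diskMean P j r) := by
  cases j with
  | LOS => exact intensity_LOS_closedBall hlam hp hD hr
  | NLOS =>
    have hadd := congrArg (· (Metric.closedBall 0 r))
      (intensity_LOS_add_intensity_NLOS hlam hp hp1)
    simp only [Measure.add_apply, Measure.smul_apply, smul_eq_mul] at hadd
    rw [intensity_LOS_closedBall hlam hp hD hr, volume_closedBall_plane hr,
      ← ENNReal.ofReal_mul hlam, add_comm] at hadd
    rw [ENNReal.eq_sub_of_add_eq ENNReal.ofReal_ne_top hadd, ← ENNReal.ofReal_sub _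
      (mul_nonneg hlam (diskMean_nonneg hp hp1 hD .LOS hr)), ← mul_sub]
    rfl

lemma intensity_LOS_univ (hlam : 0 ≤ P.lam) (hp : 0 ≤ P.p) (hD : 0 ≤ P.D) :
    intensity P .LOS univ = ENNReal.ofReal (P.lam * Real.pi * P.p * P.D ^ 2) := by
  rw [intensity_LOS, Measure.smul_apply, Measure.restrict_apply_univ, volume_closedBall_plane hD,
    smul_eq_mul, ← ENNReal.ofReal_mul (by positivity)]
  ring_nf

lemma intensity_NLOS_univ (hlam : 0 < P.lam) (hp : 0 ≤ P.p) (hp1 : P.p ≤ 1) (hD : 0 ≤ P.D) :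
    intensity P .NLOS univ = ⊤ := by
  have hadd := congrArg (· univ) (intensity_LOS_add_intensity_NLOS hlam.le hp hp1)
  simp only [Measure.add_apply, Measure.smul_apply, measure_univ_of_isAddLeftInvariant,
    smul_eq_mul] at hadd
  rw [ENNReal.mul_top (ENNReal.ofReal_pos.2 hlam).ne', intensity_LOS_univ hlam.le hp hD,
    ENNReal.add_eq_top] at hadd
  exact hadd.resolve_left ENNReal.ofReal_ne_top

lemma one_sub_expNeg_intensity_univ (hlam : 0 < P.lam) (hp : 0 ≤ P.p) (hp1 : P.p ≤ 1)
    (hD : 0 ≤ P.D) (j : LinkType) :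
    1 - expNeg (intensity P j univ) = ENNReal.ofReal (B P j) := by
  cases j with
  | LOS =>
    rw [intensity_LOS_univ hlam.le hp hD, one_sub_expNeg_ofReal (by positivity), B]
  | NLOS =>
    rw [intensity_NLOS_univ hlam hp hp1 hD, expNeg_top, tsub_zero, B, ENNReal.ofReal_one]

lemma B_pos (hlam : 0 < P.lam) (hp : 0 < P.p) (hD : 0 < P.D) (j : LinkType) : 0 < B P j := by
  cases j with
  | LOS =>
    rw [B, sub_pos, Real.exp_lt_one_iff, neg_lt_zero]
    positivity
  | NLOS => exact one_pos

end Intensity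

/-! ### The intensity of the propagation losses -/

section Loss

variable {P : Params} {j : LinkType} {t : ℝ}

lemma gain_pos (P : Params) (s : ℝ) : 0 < gain P s := Real.rpow_pos_of_pos (by norm_num) _

lemma gain_neg_mul (P : Params) (j : LinkType) (z : ℝ) :
    gain P (-P.xi j * z) = Real.exp (m P + sigma P j * z) := by
  rw [gain, Real.rpow_def_of_pos (by norm_num), m, sigma]
  ring_nf

lemma loss_nonneg (P : Params) (j : LinkType) (x : Plane) (s : ℝ) : 0 ≤ loss P j x s :=
  div_nonneg (Real.rpow_nonneg (norm_nonneg _) _) (gain_pos P s).le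

lemma measurable_loss (P : Params) (j : LinkType) :
    Measurable fun z : Plane × ℝ => loss P j z.1 z.2 := by
  unfold loss gain
  fun_prop

/-- The distance within which the loss is at most `t` when the shadowing is `-ξ_j z` dB. The sign
makes the gain increase with the standardized shadowing `z`. -/
noncomputable def coverRadius (P : Params) (j : LinkType) (t z : ℝ) : ℝ :=
  (t * Real.exp (m P + sigma P j * z)) ^ (P.alpha j)⁻¹

lemma coverRadius_nonneg (ht : 0 ≤ t) (z : ℝ) : 0 ≤ coverRadius P j t z := by
  unfold coverRadius
  positivity

lemma setOf_loss_le (ha : 0 < P.alpha j) (ht : 0 ≤ t) (z : ℝ) :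
    {x : Plane | loss P j x (-P.xi j * z) ≤ t} = Metric.closedBall 0 (coverRadius P j t z) := by
  ext x
  rw [mem_ofPred_eq, mem_closedBall_zero_iff, loss, div_le_iff₀ (gain_pos P _), gain_neg_mul,
    coverRadius, Real.le_rpow_inv_iff_of_pos (norm_nonneg x) (by positivity) ha]

lemma coverRadius_zero (ha : P.alpha j ≠ 0) (z : ℝ) : coverRadius P j 0 z = 0 := by
  rw [coverRadius, zero_mul, Real.zero_rpow (inv_ne_zero ha)]

lemma coverRadius_lt_iff (hD : 0 < P.D) (ha : 0 < P.alpha j) (hs : 0 < sigma P j) (ht : 0 < t)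
    (z : ℝ) : coverRadius P j t z < P.D ↔ z < Upsilon P j t := by
  have : 0 < P.D ^ P.alpha j := Real.rpow_pos_of_pos hD _
  rw [coverRadius, Real.rpow_inv_lt_iff_of_pos (by positivity) hD.le ha, ← lt_div_iff₀' ht,
    ← Real.lt_log_iff_exp_lt (by positivity), Upsilon, lt_div_iff₀' hs, lt_sub_iff_add_lt']

lemma coverRadius_sq (ht : 0 ≤ t) (z : ℝ) :
    coverRadius P j t z ^ 2 = t ^ (2 / P.alpha j) * Real.exp (2 * m P / P.alpha j) *
      Real.exp (2 * sigma P j / P.alpha j * z) := by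
  rw [coverRadius, ← Real.rpow_mul_natCast (by positivity), Real.mul_rpow ht (Real.exp_pos _).le,
    ← Real.exp_mul, mul_assoc, ← Real.exp_add]
  push_cast
  ring_nf

lemma expConst_eq (P : Params) (j : LinkType) :
    expConst P j = Real.exp (2 * m P / P.alpha j) *
      Real.exp ((2 * sigma P j / P.alpha j) ^ 2 / 2) := by
  rw [expConst, ← Real.exp_add]
  ring_nf

lemma integrable_coverRadius_sq (ht : 0 ≤ t) :
    Integrable (fun z => coverRadius P j t z ^ 2) (gaussianReal 0 1) := by
  simp_rw [coverRadius_sq ht]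
  exact (integrable_exp_mul_gaussianReal _).const_mul _

lemma integral_coverRadius_sq (ht : 0 ≤ t) :
    ∫ z, coverRadius P j t z ^ 2 ∂(gaussianReal 0 1) = t ^ (2 / P.alpha j) * expConst P j := by
  simp_rw [coverRadius_sq ht]
  rw [integral_const_mul, integral_exp_mul_gaussianReal, expConst_eq, mul_assoc]

lemma setIntegral_coverRadius_sq (hs : sigma P j ≠ 0) (ht : 0 ≤ t) :
    ∫ z in Iio (Upsilon P j t), coverRadius P j t z ^ 2 ∂(gaussianReal 0 1) =
      t ^ (2 / P.alpha j) * expConst P j * qShift P j t := by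
  simp_rw [coverRadius_sq ht]
  rw [integral_const_mul, setIntegral_exp_mul_gaussianReal, qShift, expConst_eq,
    pow_two (sigma P j), ← mul_assoc 2, mul_div_mul_right _ _ hs]
  ring

lemma integrable_min_coverRadius_sq (hD : 0 ≤ P.D) (ht : 0 ≤ t) :
    Integrable (fun z => min (coverRadius P j t z) P.D ^ 2) (gaussianReal 0 1) := by
  have hmeas : Measurable (coverRadius P j t) := by
    unfold coverRadius
    fun_prop
  refine (integrable_coverRadius_sq (P := P) (j := j) ht).mono'
    ((hmeas.min measurable_const).pow_const 2).aestronglyMeasurable (ae_of_all _ fun z => ?_)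
  rw [Real.norm_of_nonneg (sq_nonneg _)]
  exact pow_le_pow_left₀ (le_min (coverRadius_nonneg ht z) hD) (min_le_left _ _) 2

lemma integral_min_coverRadius_sq (hD : 0 < P.D) (ha : 0 < P.alpha j) (hs : 0 < sigma P j)
    (ht : 0 < t) :
    ∫ z, min (coverRadius P j t z) P.D ^ 2 ∂(gaussianReal 0 1) = truncSqMean P j t := by
  have hlt := coverRadius_lt_iff hD ha hs ht
  have hnear : ∫ z in Iio (Upsilon P j t), min (coverRadius P j t z) P.D ^ 2 ∂(gaussianReal 0 1) =
      t ^ (2 / P.alpha j) * expConst P j * qShift P j t := by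
    rw [← setIntegral_coverRadius_sq hs.ne' ht.le]
    refine setIntegral_congr_fun measurableSet_Iio fun z hz => ?_
    simp only [min_eq_left ((hlt z).2 hz).le]
  have hfar : ∫ z in Ici (Upsilon P j t), min (coverRadius P j t z) P.D ^ 2 ∂(gaussianReal 0 1) =
      P.D ^ 2 * Q (Upsilon P j t) := by
    have : NullSingletonClass (gaussianReal 0 1) := nullSingletonClass_gaussianReal one_ne_zero
    rw [Q, measureReal_congr Ioi_ae_eq_Ici, mul_comm, ← smul_eq_mul, ← setIntegral_const]
    refine setIntegral_congr_fun measurableSet_Ici fun z hz => ?_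
    simp only [min_eq_right (not_lt.1 (mt (hlt z).1 (not_lt.2 hz)))]
  rw [← integral_add_compl measurableSet_Iio (s := Iio (Upsilon P j t))
    (integrable_min_coverRadius_sq hD.le ht.le), compl_Iio, hnear, hfar, truncSqMean, add_comm]

lemma integrable_diskMean_coverRadius (hD : 0 ≤ P.D) (ht : 0 ≤ t) :
    Integrable (fun z => diskMean P j (coverRadius P j t z)) (gaussianReal 0 1) := by
  have hmin := (integrable_min_coverRadius_sq (P := P) (j := j) hD ht).const_mul (Real.pi * P.p)
  cases j with
  | LOS => exact hmin
  | NLOS => exact ((integrable_coverRadius_sq ht).const_mul Real.pi).sub hmin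

lemma integral_diskMean_coverRadius (hD : 0 < P.D) (ha : 0 < P.alpha j) (hs : 0 < sigma P j)
    (ht : 0 < t) :
    ∫ z, diskMean P j (coverRadius P j t z) ∂(gaussianReal 0 1) = M P j t := by
  cases j with
  | LOS =>
    simp only [diskMean]
    rw [integral_const_mul, integral_min_coverRadius_sq hD ha hs ht, M_LOS]
  | NLOS =>
    simp only [diskMean]
    rw [integral_sub ((integrable_coverRadius_sq ht.le).const_mul _)
        ((integrable_min_coverRadius_sq hD.le ht.le).const_mul _), integral_const_mul,
      integral_const_mul, integral_coverRadius_sq ht.le, integral_min_coverRadius_sq hD ha hs ht,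
      M_NLOS]

lemma gaussianReal_shadowing (P : Params) (j : LinkType) :
    gaussianReal 0 (P.xi j ^ 2).toNNReal = (gaussianReal 0 1).map (fun z => -P.xi j * z) := by
  rw [gaussianReal_map_const_mul, mul_zero, mul_one]
  congr 1
  ext
  simp [Real.coe_toNNReal _ (sq_nonneg (P.xi j))]

end Loss

/-! ### The point of the propagation process nearest to the origin -/

section Nearest

/-- The intensity measure of the propagation process, the image of the intensity of the marked base
stations under the loss. -/
noncomputable def lossIntensity (P : Params) (j : LinkType) : Measure ℝ :=
  ((intensity P j).prod (gaussianReal 0 (P.xi j ^ 2).toNNReal)).map fun z => loss P j z.1 z.2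

variable {P : Params} {j : LinkType} {t : ℝ}

lemma lossIntensity_apply {s : Set ℝ} (hs : MeasurableSet s) :
    lossIntensity P j s = (intensity P j).prod (gaussianReal 0 (P.xi j ^ 2).toNNReal)
      ((fun z => loss P j z.1 z.2) ⁻¹' s) :=
  Measure.map_apply (measurable_loss P j) hs

lemma lossIntensity_Iic_eq_lintegral (hlam : 0 ≤ P.lam) (hp : 0 ≤ P.p) (hp1 : P.p ≤ 1)
    (hD : 0 ≤ P.D) (ha : 0 < P.alpha j) (ht : 0 ≤ t) :
    lossIntensity P j (Iic t) =
      ∫⁻ z, ENNReal.ofReal (P.lam * diskMean P j (coverRadius P j t z)) ∂(gaussianReal 0 1) := by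
  have hT := measurable_loss P j (measurableSet_Iic (a := t))
  rw [lossIntensity_apply measurableSet_Iic, Measure.prod_apply_symm hT, gaussianReal_shadowing,
    lintegral_map (measurable_measure_prodMk_right hT) (by fun_prop)]
  refine lintegral_congr fun z => ?_
  rw [← intensity_closedBall hlam hp hp1 hD j (coverRadius_nonneg ht z), ← setOf_loss_le ha ht]
  rfl

lemma lossIntensity_Iic_zero (hlam : 0 ≤ P.lam) (hp : 0 ≤ P.p) (hp1 : P.p ≤ 1)
    (hD : 0 ≤ P.D) (ha : 0 < P.alpha j) : lossIntensity P j (Iic 0) = 0 := by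
  have hdisk : diskMean P j 0 = 0 := by cases j <;> simp [diskMean, hD]
  simp [lossIntensity_Iic_eq_lintegral hlam hp hp1 hD ha le_rfl, coverRadius_zero ha.ne', hdisk]

theorem lossIntensity_Iic (hlam : 0 ≤ P.lam) (hp : 0 ≤ P.p) (hp1 : P.p ≤ 1) (hD : 0 < P.D)
    (ha : 0 < P.alpha j) (hxi : 0 < P.xi j) (ht : 0 < t) :
    lossIntensity P j (Iic t) = ENNReal.ofReal (P.lam * M P j t) := by
  rw [lossIntensity_Iic_eq_lintegral hlam hp hp1 hD.le ha ht.le,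
    ← integral_diskMean_coverRadius hD ha (sigma_pos hxi) ht, ← integral_const_mul,
    ofReal_integral_eq_lintegral_ofReal ((integrable_diskMean_coverRadius hD.le ht.le).const_mul _)]
  exact ae_of_all _ fun z =>
    mul_nonneg hlam (diskMean_nonneg hp hp1 hD.le j (coverRadius_nonneg ht.le z))

lemma lossIntensity_Iic_ne_top (hlam : 0 ≤ P.lam) (hp : 0 ≤ P.p) (hp1 : P.p ≤ 1) (hD : 0 < P.D)
    (ha : 0 < P.alpha j) (hxi : 0 < P.xi j) (t : ℝ) : lossIntensity P j (Iic t) ≠ ⊤ := by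
  refine ne_top_of_le_ne_top ?_ (measure_mono (Iic_subset_Iic.2 (le_max_left t 1)))
  rw [lossIntensity_Iic hlam hp hp1 hD ha hxi (lt_max_of_lt_right one_pos)]
  exact ENNReal.ofReal_ne_top

lemma M_nonneg (hp : 0 ≤ P.p) (hp1 : P.p ≤ 1) (hD : 0 < P.D) (ha : 0 < P.alpha j)
    (hxi : 0 < P.xi j) (ht : 0 < t) : 0 ≤ M P j t := by
  rw [← integral_diskMean_coverRadius hD ha (sigma_pos hxi) ht]
  exact integral_nonneg fun z => diskMean_nonneg hp hp1 hD.le j (coverRadius_nonneg ht.le z)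

variable {Ω : Type*} [MeasurableSpace Ω] {μ : Measure Ω} {Φ : RandomPoints Ω Plane}
  {χ : ℕ → Ω → ℝ}

/-- The conditional law of the distance from the origin to the nearest point of the propagation
process, given that this process is not empty. -/
noncomputable def nearestLaw (P : Params) (j : LinkType) (Φ : RandomPoints Ω Plane)
    (χ : ℕ → Ω → ℝ) (μ : Measure Ω) : Measure ℝ :=
  (cond μ (nonemptyEvent P j Φ χ)).map (nearest P j Φ χ)

lemma bddBelow_range_loss (P : Params) (j : LinkType) :
    BddBelow (range fun z : Plane × ℝ => loss P j z.1 z.2) :=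
  ⟨0, forall_mem_range.2 fun z => loss_nonneg P j z.1 z.2⟩

lemma IsBSProcess.measurableSet_nonemptyEvent (h : IsBSProcess P j Φ χ μ) :
    MeasurableSet (nonemptyEvent P j Φ χ) :=
  h.poisson.measurableSet_markedImage_nonempty h.marking (measurable_loss P j)

lemma IsBSProcess.measurable_nearest (h : IsBSProcess P j Φ χ μ) :
    Measurable (nearest P j Φ χ) :=
  h.poisson.measurable_sInf_markedImage h.marking (measurable_loss P j) (bddBelow_range_loss P j)

theorem IsBSProcess.measure_nonemptyEvent (h : IsBSProcess P j Φ χ μ) (hlam : 0 < P.lam)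
    (hp : 0 ≤ P.p) (hp1 : P.p ≤ 1) (hD : 0 ≤ P.D) :
    μ (nonemptyEvent P j Φ χ) = ENNReal.ofReal (B P j) :=
  (h.poisson.measure_markedImage_nonempty h.marking (measurable_loss P j)).trans
    (one_sub_expNeg_intensity_univ hlam hp hp1 hD j)

theorem IsBSProcess.ae_isLeast_nearest (h : IsBSProcess P j Φ χ μ)
    (hfin : ∀ t, lossIntensity P j (Iic t) ≠ ⊤) :
    ∀ᵐ ω ∂(cond μ (nonemptyEvent P j Φ χ)),
      IsLeast (propagation P j Φ χ ω) (nearest P j Φ χ ω) := by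
  simp_rw [lossIntensity_apply measurableSet_Iic] at hfin
  filter_upwards [cond_absolutelyContinuous.ae_le (h.poisson.ae_isLeast_sInf_markedImage h.marking
    (measurable_loss P j) hfin), ae_cond_mem h.measurableSet_nonemptyEvent] with ω hω using hω

lemma IsBSProcess.measure_nearest_le (h : IsBSProcess P j Φ χ μ)
    (hfin : ∀ t, lossIntensity P j (Iic t) ≠ ⊤) (t : ℝ) :
    μ (nonemptyEvent P j Φ χ ∩ nearest P j Φ χ ⁻¹' Iic t) =
      1 - expNeg (lossIntensity P j (Iic t)) := by
  simp_rw [lossIntensity_apply measurableSet_Iic] at hfin ⊢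
  exact h.poisson.measure_sInf_markedImage_le h.marking (measurable_loss P j)
    (bddBelow_range_loss P j) hfin t

lemma IsBSProcess.nearestLaw_Iic (h : IsBSProcess P j Φ χ μ)
    (hfin : ∀ t, lossIntensity P j (Iic t) ≠ ⊤) (t : ℝ) :
    nearestLaw P j Φ χ μ (Iic t) =
      (μ (nonemptyEvent P j Φ χ))⁻¹ * (1 - expNeg (lossIntensity P j (Iic t))) := by
  rw [nearestLaw, Measure.map_apply h.measurable_nearest measurableSet_Iic,
    cond_apply h.measurableSet_nonemptyEvent, h.measure_nearest_le hfin]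

section NearestLaw

variable (hlam : 0 < P.lam) (hp : 0 < P.p) (hp1 : P.p ≤ 1) (hD : 0 < P.D)
include hlam hp hp1 hD

lemma IsBSProcess.isProbabilityMeasure_nearestLaw (h : IsBSProcess P j Φ χ μ) :
    IsProbabilityMeasure (nearestLaw P j Φ χ μ) := by
  have := h.marking.iIndep_mark.isProbabilityMeasure
  have : IsProbabilityMeasure (cond μ (nonemptyEvent P j Φ χ)) := cond_isProbabilityMeasure <| by
    rw [h.measure_nonemptyEvent hlam hp.le hp1 hD.le]
    exact (ENNReal.ofReal_pos.2 (B_pos hlam hp hD j)).ne'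
  exact Measure.isProbabilityMeasure_map h.measurable_nearest.aemeasurable

variable (ha : 0 < P.alpha j) (hxi : 0 < P.xi j)
include ha hxi

lemma IsBSProcess.nearestLaw_Iic_zero (h : IsBSProcess P j Φ χ μ) :
    nearestLaw P j Φ χ μ (Iic 0) = 0 := by
  rw [h.nearestLaw_Iic (lossIntensity_Iic_ne_top hlam.le hp.le hp1 hD ha hxi),
    lossIntensity_Iic_zero hlam.le hp.le hp1 hD.le ha, expNeg_zero, tsub_self, mul_zero]

lemma IsBSProcess.cdf_nearestLaw (h : IsBSProcess P j Φ χ μ) (ht : 0 < t) :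
    cdf (nearestLaw P j Φ χ μ) t = (1 - Real.exp (-(P.lam * M P j t))) / B P j := by
  have := h.isProbabilityMeasure_nearestLaw hlam hp hp1 hD
  have hM := mul_nonneg hlam.le (M_nonneg hp.le hp1 hD ha hxi ht)
  rw [cdf_eq_real, Measure.real,
    h.nearestLaw_Iic (lossIntensity_Iic_ne_top hlam.le hp.le hp1 hD ha hxi),
    h.measure_nonemptyEvent hlam hp.le hp1 hD.le,
    lossIntensity_Iic hlam.le hp.le hp1 hD ha hxi ht, one_sub_expNeg_ofReal hM,
    ENNReal.toReal_mul, ENNReal.toReal_inv, ENNReal.toReal_ofReal (B_pos hlam hp hD j).le,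
    ENNReal.toReal_ofReal (sub_nonneg.2 (Real.exp_le_one_iff.2 (neg_nonpos.2 hM))),
    inv_mul_eq_div]

lemma IsBSProcess.hasDerivAt_cdf_nearestLaw (h : IsBSProcess P j Φ χ μ) (ht : 0 < t) :
    HasDerivAt (cdf (nearestLaw P j Φ χ μ)) (f P j t) t := by
  have hcdf : HasDerivAt (fun s => (1 - Real.exp (-(P.lam * M P j s))) / B P j) (f P j t) t := by
    refine (((((hasDerivAt_M hp.ne' hD hxi ht).const_mul P.lam).neg.exp).const_sub
      1).div_const (B P j)).congr_deriv ?_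
    rw [f, Pi.neg_apply]
    ring
  refine hcdf.congr_of_eventuallyEq ?_
  filter_upwards [lt_mem_nhds ht] with s hs using h.cdf_nearestLaw hlam hp hp1 hD ha hxi hs

lemma IsBSProcess.f_nonneg (h : IsBSProcess P j Φ χ μ) (ht : 0 < t) : 0 ≤ f P j t :=
  (h.hasDerivAt_cdf_nearestLaw hlam hp hp1 hD ha hxi ht).nonneg_of_monotone (monotone_cdf _)

theorem IsBSProcess.nearestLaw_eq_withDensity (h : IsBSProcess P j Φ χ μ) :
    nearestLaw P j Φ χ μ =
      (volume.restrict (Ioi (0 : ℝ))).withDensity fun t => ENNReal.ofReal (f P j t) := by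
  have := h.isProbabilityMeasure_nearestLaw hlam hp hp1 hD
  exact eq_withDensity_of_hasDerivAt_cdf
    (fun t ht => h.hasDerivAt_cdf_nearestLaw hlam hp hp1 hD ha hxi ht)
    (h.nearestLaw_Iic_zero hlam hp hp1 hD ha hxi)

end NearestLaw

end Nearest

end MmWave

theorem lemma5 {Ω : Type*} [MeasurableSpace Ω] (μ : Measure Ω) [IsProbabilityMeasure μ]
    (P : MmWave.Params) (hlam : 0 < P.lam) (hp : 0 < P.p) (hp1 : P.p ≤ 1) (hD : 0 < P.D)
    (halpha : ∀ j, 0 < P.alpha j) (hxi : ∀ j, 0 < P.xi j)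
    (j : MmWave.LinkType) (Φ : MmWave.RandomPoints Ω MmWave.Plane) (χ : ℕ → Ω → ℝ)
    (hΦ : MmWave.IsBSProcess P j Φ χ μ) :
    -- `M'_j` is the derivative of `M_j`, and `B_j` is the probability of the conditioning event
    (∀ t : ℝ, 0 < t → HasDerivAt (MmWave.M P j) (MmWave.M' P j t) t) ∧
    μ (MmWave.nonemptyEvent P j Φ χ) = ENNReal.ofReal (MmWave.B P j) ∧
    0 < MmWave.B P j ∧
    -- given that the propagation process is not empty, it has a point nearest to the origin
    (∀ᵐ ω ∂(ProbabilityTheory.cond μ (MmWave.nonemptyEvent P j Φ χ)),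
      IsLeast (MmWave.propagation P j Φ χ ω) (MmWave.nearest P j Φ χ ω)) ∧
    -- and the distance of this point has, under the conditional law, the density `f_j` on `(0, ∞)`
    AEMeasurable (MmWave.nearest P j Φ χ)
      (ProbabilityTheory.cond μ (MmWave.nonemptyEvent P j Φ χ)) ∧
    (∀ t : ℝ, 0 < t → 0 ≤ MmWave.f P j t) ∧
    (ProbabilityTheory.cond μ (MmWave.nonemptyEvent P j Φ χ)).map (MmWave.nearest P j Φ χ) =
      (volume.restrict (Set.Ioi (0 : ℝ))).withDensity
        (fun t => ENNReal.ofReal (MmWave.f P j t)) := by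
  have hfin := MmWave.lossIntensity_Iic_ne_top hlam.le hp.le hp1 hD (halpha j) (hxi j)
  exact ⟨fun t ht => MmWave.hasDerivAt_M hp.ne' hD (hxi j) ht,
    hΦ.measure_nonemptyEvent hlam hp.le hp1 hD.le,
    MmWave.B_pos hlam hp hD j,
    hΦ.ae_isLeast_nearest hfin,
    hΦ.measurable_nearest.aemeasurable,
    fun t ht => hΦ.f_nonneg hlam hp hp1 hD (halpha j) (hxi j) ht,
    hΦ.nearestLaw_eq_withDensity hlam hp hp1 hD (halpha j) (hxi j)⟩
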